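/- Let $n\ge 1$, $m\ge 1$, $0\le\gamma<1$, let $A_1,\dots,A_m$ be invertible real $n\times n$ matrices such that $A_k-A_{k'}$ is invertible for $k\ne k'$, and let $\gamma_1,\dots,\gamma_m>0$ satisfy $\gamma_1+\cdots+\gamma_m=n(1-\gamma)$. Put $$Tf(x)=\int_{\mathbb R^n}|x-A_1y|^{-\gamma_1}\cdots|x-A_my|^{-\gamma_m}f(y)\,dy .$$ All cubes are closed, of positive side length, with sides parallel to the axes; $|E|$ denotes the Lebesgue measure of $E$. For a cube $Q_0\subset\mathbb R^n$, $0<s\le 1/2$, a measurable $g:\mathbb R^n\to\mathbb R$ and $x\in Q_0$ let $$M^{\sharp}_{0,s,Q_0}g(x)=\sup_{x\in Q,\ Q\subset Q_0}\ \inf_{c'\in\mathbb R}\ \inf\{\alpha\ge 0:\ |\{y\in Q:|g(y)-c'|>\alpha\}|<s|Q|\},$$ the supremum being over cubes $Q$, and let $$M_\gamma f(x)=\sup_{Q\ni x}\frac1{|Q|^{1-\gamma}}\int_Q|f(y)|\,dy\in[0,\infty],$$ the supremum being over all cubes $Q\subset\mathbb R^n$ containing $x$. **Theorem 2.3.** For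 every $0<s\le 1/2$ there is a finite constant $c\ge 0$, depending only on $n,m,\gamma,s$, the $\gamma_i$ and the $A_i$, such that for every measurable $f:\mathbb R^n\to\mathbb R$ for which the integral defining $Tf(x)$ converges absolutely for almost every $x\in\mathbb R^n$, every cube $Q_0\subset\mathbb R^n$ and every $x\in Q_0$, $$M^{\sharp}_{0,s,Q_0}(Tf)(x)\le c\sum_{i=1}^m\ \sup_{x\in Q,\ Q\subset Q_0}\ \inf_{y\in Q}M_\gamma f(A_i^{-1}y).$$ -/

import Mathlib

open MeasureTheory
open scoped ENNReal NNReal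

namespace FracHom

/-- A (closed, nondegenerate) cube of `ℝⁿ` with sides parallel to the axes. -/
def IsCube {n : ℕ} (Q : Set (EuclideanSpace ℝ (Fin n))) : Prop :=
  ∃ (a : EuclideanSpace ℝ (Fin n)) (l : ℝ), 0 < l ∧
    Q = {y | ∀ j, a j ≤ y j ∧ y j ≤ a j + l}

/-- The local mean oscillation of `g` on `Q` with parameter `s`:
`inf_c inf {α ≥ 0 : |{y ∈ Q : |g y - c| > α}| < s |Q|}`. -/
noncomputable def medianOsc {n : ℕ} (s : ℝ) (g : EuclideanSpace ℝ (Fin n) → ℝ)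
    (Q : Set (EuclideanSpace ℝ (Fin n))) : ℝ≥0∞ :=
  ⨅ (c : ℝ) (α : ℝ≥0)
    (_ : volume {y | y ∈ Q ∧ (α : ℝ) < |g y - c|} < ENNReal.ofReal s * volume Q), (α : ℝ≥0∞)

/-- The local sharp maximal function of `g` restricted to the cube `Q₀`. -/
noncomputable def localSharp {n : ℕ} (s : ℝ) (Q₀ : Set (EuclideanSpace ℝ (Fin n)))
    (g : EuclideanSpace ℝ (Fin n) → ℝ) (x : EuclideanSpace ℝ (Fin n)) : ℝ≥0∞ :=
  ⨆ (Q : Set (EuclideanSpace ℝ (Fin n))) (_ : IsCube Q) (_ : x ∈ Q) (_ : Q ⊆ Q₀),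
    medianOsc s g Q

/-- The fractional maximal function `sup_{Q ∋ x} |Q|^{γ - 1} ∫_Q |f|`, with values in `[0, ∞]`. -/
noncomputable def fracMax {n : ℕ} (γ : ℝ) (f : EuclideanSpace ℝ (Fin n) → ℝ)
    (x : EuclideanSpace ℝ (Fin n)) : ℝ≥0∞ :=
  ⨆ (Q : Set (EuclideanSpace ℝ (Fin n))) (_ : IsCube Q) (_ : x ∈ Q),
    (volume Q) ^ (γ - 1) * ∫⁻ y in Q, ‖f y‖ₑ

/-- The kernel `∏ᵢ |x - Aᵢ y|^{-γᵢ}`. -/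
noncomputable def homKernel {n m : ℕ} (A : Fin m → Matrix (Fin n) (Fin n) ℝ) (γs : Fin m → ℝ)
    (x y : EuclideanSpace ℝ (Fin n)) : ℝ :=
  ∏ i, ‖x - Matrix.toEuclideanLin (A i) y‖ ^ (-γs i)

/-- The integral operator with kernel `homKernel A γs`. -/
noncomputable def homOp {n m : ℕ} (A : Fin m → Matrix (Fin n) (Fin n) ℝ) (γs : Fin m → ℝ)
    (f : EuclideanSpace ℝ (Fin n) → ℝ) (x : EuclideanSpace ℝ (Fin n)) : ℝ :=
  ∫ y, homKernel A γs x y * f y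

end FracHom

/-!
Let `N = ∑ i, γs i = n (1 - γ)` and let `Q` be a cube of side `l`. Since only the *median*
oscillation on `Q` matters, a ball `W` around `0` of measure at most `s |Q| / 4` may be discarded.
The maps `A i` being separated, `|x - A i y|` and `|x - A j y|` cannot both be much smaller than
`|x|`; so for `x ∈ Q \ W` at most one factor of the kernel is singular at scale `l`, and if all
`γs i < n` the kernel integrates over `Q \ W` to at most `C l ^ (-N) |Q|`, uniformly in `y`.

Fix `x₀ ∈ Q` at which `T f` converges. The part of `f` where some `|x₀ - A i y|` is `≲ l` is
controlled by Tonelli and Chebyshev; for the rest, `|K (x, y) - K (x₀, y)| ≲ l d ^ (-N - 1)` with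
`d = min |x₀ - A i y|`, and a dyadic decomposition in `d` applies. Both reduce to the integrals of
`|f|` over `{y | |x₀ - A i y| < ρ}` with `ρ ≳ l`, which are at most a multiple of `ρ ^ N M_γ f` at
each point of the image of `Q` under the inverse of `A i`.

If some `γs i ≥ n`, then absolute convergence at `A i z` forces the mean of `|f|` over small balls
around `z` to tend to zero, so `f = 0` almost everywhere by Lebesgue differentiation.
-/

namespace FracHom

/-! ### Singular powers of the norm -/

section NormPower

variable {E : Type*} [NormedAddCommGroup E] [NormedSpace ℝ E] [FiniteDimensional ℝ E]
  [MeasurableSpace E] [BorelSpace E] (μ : Measure E) [μ.IsAddHaarMeasure]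

theorem lintegral_comp_inv_smul_sub {φ : E → ℝ≥0∞} (hφ : Measurable φ) (b : E) {r : ℝ}
    (hr : 0 < r) :
    ∫⁻ x, φ (r⁻¹ • (x - b)) ∂μ = ENNReal.ofReal (r ^ Module.finrank ℝ E) * ∫⁻ x, φ x ∂μ := by
  rw [lintegral_sub_right_eq_self (fun x => φ (r⁻¹ • x)) b,
    ← lintegral_map hφ (measurable_const_smul r⁻¹),
    Measure.map_addHaar_smul μ (inv_ne_zero hr.ne'), lintegral_smul_measure, inv_pow, inv_inv,
    abs_of_pos (by positivity), smul_eq_mul]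

theorem lintegral_ball_norm_rpow_lt_top {g : ℝ} (hg₀ : 0 ≤ g) (hg : g < Module.finrank ℝ E)
    (r : ℝ) : ∫⁻ x in Metric.ball 0 r, ENNReal.ofReal (‖x‖ ^ (-g)) ∂μ < ∞ := by
  have hdim : 1 ≤ Module.finrank ℝ E := Nat.one_le_iff_ne_zero.2 fun h => by
    rw [h, Nat.cast_zero] at hg
    exact hg₀.not_gt hg
  have hint : IntegrableOn (fun x : E => ‖x‖ ^ (-g)) (Metric.ball 0 r) μ :=
    integrableOn_ball_of_norm_le_rpow hdim (C := 1) hg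
      (ae_of_all _ fun x => by rw [one_mul, Real.norm_of_nonneg (by positivity)])
      (measurable_norm.pow_const _).aestronglyMeasurable
  exact (hasFiniteIntegral_iff_ofReal (ae_of_all _ fun x => by positivity)).1 hint.2

theorem setLIntegral_norm_sub_div_rpow_le {g : ℝ} (hg : 0 ≤ g) (S : Set E) (b : E) {r : ℝ}
    (hr : 0 < r) :
    ∫⁻ x in S, ENNReal.ofReal ((‖x - b‖ / r) ^ (-g)) ∂μ ≤
      ENNReal.ofReal (r ^ Module.finrank ℝ E) *
        (∫⁻ x in Metric.ball 0 1, ENNReal.ofReal (‖x‖ ^ (-g)) ∂μ) + μ S := by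
  set φ : E → ℝ≥0∞ := (Metric.ball 0 1).indicator fun x => ENNReal.ofReal (‖x‖ ^ (-g))
  have hφ : Measurable φ := Measurable.indicator (by fun_prop) measurableSet_ball
  have hpt (x : E) : ENNReal.ofReal ((‖x - b‖ / r) ^ (-g)) ≤ φ (r⁻¹ • (x - b)) + 1 := by
    have hnorm : ‖r⁻¹ • (x - b)‖ = ‖x - b‖ / r := by
      rw [norm_smul, norm_inv, Real.norm_of_nonneg hr.le, inv_mul_eq_div]
    rw [← hnorm]
    by_cases hx : r⁻¹ • (x - b) ∈ Metric.ball 0 1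
    · simp only [φ, Set.indicator_of_mem hx, le_self_add]
    · rw [mem_ball_zero_iff, not_lt] at hx
      refine le_add_left (ENNReal.ofReal_le_one.2 ?_)
      exact Real.rpow_le_one_of_one_le_of_nonpos hx (neg_nonpos.2 hg)
  calc ∫⁻ x in S, ENNReal.ofReal ((‖x - b‖ / r) ^ (-g)) ∂μ
      ≤ ∫⁻ x in S, (φ (r⁻¹ • (x - b)) + 1) ∂μ := lintegral_mono hpt
    _ = (∫⁻ x in S, φ (r⁻¹ • (x - b)) ∂μ) + μ S := by
        rw [lintegral_add_right _ measurable_const, setLIntegral_one]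
    _ ≤ (∫⁻ x, φ (r⁻¹ • (x - b)) ∂μ) + μ S := by
        gcongr
        exact Measure.restrict_le_self
    _ = _ := by
        rw [lintegral_comp_inv_smul_sub μ hφ b hr, lintegral_indicator measurableSet_ball]

end NormPower

/-! ### Products of negative powers -/

section ProductsOfPowers

variable {ι : Type*} {d e g : ι → ℝ}

theorem prod_rpow_neg_le {s : Finset ι} (hg : ∀ i, 0 ≤ g i) {t : ℝ} (ht : 0 < t)
    (hd : ∀ i ∈ s, t ≤ d i) : ∏ i ∈ s, d i ^ (-g i) ≤ t ^ (-∑ i ∈ s, g i) := by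
  rw [← Finset.sum_neg_distrib, Real.rpow_sum_of_pos ht]
  exact Finset.prod_le_prod (fun i hi => Real.rpow_nonneg (ht.le.trans (hd i hi)) _) fun i hi =>
    Real.rpow_le_rpow_of_nonpos ht (hd i hi) (neg_nonpos.2 (hg i))

theorem prod_rpow_neg_le_one_add_sum [Fintype ι] (hg : ∀ i, 0 ≤ g i) (hd : ∀ i, 0 ≤ d i)
    (hsep : ∀ i j, i ≠ j → 1 ≤ max (d i) (d j)) :
    ∏ i, d i ^ (-g i) ≤ 1 + ∑ i, d i ^ (-g i) := by
  classical
  have hterm : ∀ i ∈ Finset.univ, 0 ≤ d i ^ (-g i) := fun i _ => Real.rpow_nonneg (hd i) _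
  by_cases hall : ∀ i, 1 ≤ d i
  · refine le_add_of_le_of_nonneg ?_ (Finset.sum_nonneg hterm)
    exact (prod_rpow_neg_le hg one_pos fun i _ => hall i).trans_eq (Real.one_rpow _)
  · push Not at hall
    obtain ⟨k, hk⟩ := hall
    have hother : ∏ i ∈ Finset.univ.erase k, d i ^ (-g i) ≤ 1 := by
      refine (prod_rpow_neg_le hg one_pos fun i hi => ?_).trans_eq (Real.one_rpow _)
      exact (le_max_iff.1 (hsep i k (Finset.ne_of_mem_erase hi))).resolve_right hk.not_ge
    calc ∏ i, d i ^ (-g i) = d k ^ (-g k) * ∏ i ∈ Finset.univ.erase k, d i ^ (-g i) :=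
          (Finset.mul_prod_erase _ _ (Finset.mem_univ k)).symm
      _ ≤ d k ^ (-g k) := mul_le_of_le_one_right (hterm k (Finset.mem_univ k)) hother
      _ ≤ ∑ i, d i ^ (-g i) := Finset.single_le_sum hterm (Finset.mem_univ k)
      _ ≤ _ := le_add_of_nonneg_left zero_le_one

theorem abs_exp_sub_one_le_abs_mul_exp (w : ℝ) : |Real.exp w - 1| ≤ |w| * Real.exp |w| := by
  have h := Complex.norm_exp_sub_sum_le_norm_mul_exp (w : ℂ) 1
  simp only [Finset.range_one, Finset.sum_singleton, pow_zero, Nat.factorial_zero, Nat.cast_one,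
    div_one, pow_one, Complex.norm_real, Real.norm_eq_abs] at h
  exact_mod_cast h

theorem abs_log_div_le {a b R : ℝ} (hR : 0 < R) (ha : 2 * R ≤ a) (hab : |b - a| ≤ R) :
    |Real.log (b / a)| ≤ 2 * R / a := by
  have ha₀ : 0 < a := by linarith
  obtain ⟨hlow, hupp⟩ := abs_le.1 hab
  have hb₀ : 0 < b := by linarith
  refine abs_le.2 ⟨?_, ?_⟩
  · refine le_trans ?_ (Real.one_sub_inv_le_log_of_pos (div_pos hb₀ ha₀))
    rw [inv_div, one_sub_div hb₀.ne', ← neg_div, div_le_div_iff₀ ha₀ hb₀]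
    nlinarith
  · refine (Real.log_le_sub_one_of_pos (div_pos hb₀ ha₀)).trans ?_
    rw [div_sub_one ha₀.ne']
    gcongr
    linarith

variable [Fintype ι]

theorem prod_rpow_neg_eq_mul_exp (hd : ∀ i, 0 < d i) (he : ∀ i, 0 < e i) :
    ∏ i, e i ^ (-g i) =
      (∏ i, d i ^ (-g i)) * Real.exp (∑ i, -g i * Real.log (e i / d i)) := by
  rw [Real.exp_sum, ← Finset.prod_mul_distrib]
  refine Finset.prod_congr rfl fun i _ => ?_
  have hed : 0 < e i / d i := div_pos (he i) (hd i)
  rw [mul_comm (-g i), ← Real.rpow_def_of_pos hed, ← Real.mul_rpow (hd i).le hed.le,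
    mul_div_cancel₀ _ (hd i).ne']

theorem abs_sum_mul_log_div_le (hg : ∀ i, 0 ≤ g i) {R t : ℝ} (hR : 0 < R) (ht : 2 * R ≤ t)
    (hd : ∀ i, t ≤ d i) (hde : ∀ i, |e i - d i| ≤ R) :
    |∑ i, -g i * Real.log (e i / d i)| ≤ (∑ i, g i) * (2 * R / t) := by
  rw [Finset.sum_mul]
  refine (Finset.abs_sum_le_sum_abs _ _).trans (Finset.sum_le_sum fun i _ => ?_)
  have ht₀ : 0 < t := by linarith
  rw [abs_mul, abs_neg, abs_of_nonneg (hg i)]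
  refine mul_le_mul_of_nonneg_left ?_ (hg i)
  calc |Real.log (e i / d i)| ≤ 2 * R / d i := abs_log_div_le hR (ht.trans (hd i)) (hde i)
    _ ≤ 2 * R / t := div_le_div_of_nonneg_left (by positivity) ht₀ (hd i)

theorem abs_prod_rpow_neg_sub_le (hg : ∀ i, 0 ≤ g i) {R t : ℝ} (hR : 0 < R) (ht : 2 * R ≤ t)
    (hd : ∀ i, t ≤ d i) (hde : ∀ i, |e i - d i| ≤ R) :
    |∏ i, e i ^ (-g i) - ∏ i, d i ^ (-g i)| ≤
      2 * (∑ i, g i) * Real.exp (∑ i, g i) * R * t ^ (-(∑ i, g i + 1)) := by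
  set N := ∑ i, g i
  set w := ∑ i, -g i * Real.log (e i / d i)
  have ht₀ : 0 < t := by linarith
  have hN : 0 ≤ N := Finset.sum_nonneg fun i _ => hg i
  have hd₀ : ∀ i, 0 < d i := fun i => ht₀.trans_le (hd i)
  have he₀ : ∀ i, 0 < e i := fun i => by linarith [hd i, (abs_le.1 (hde i)).1]
  have hw : |w| ≤ N * (2 * R / t) := abs_sum_mul_log_div_le hg hR ht hd hde
  have hwN : |w| ≤ N := hw.trans (mul_le_of_le_one_right hN ((div_le_one ht₀).2 ht))
  have hprod : 0 ≤ ∏ i, d i ^ (-g i) :=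
    Finset.prod_nonneg fun i _ => Real.rpow_nonneg (hd₀ i).le _
  calc |∏ i, e i ^ (-g i) - ∏ i, d i ^ (-g i)|
      = (∏ i, d i ^ (-g i)) * |Real.exp w - 1| := by
        rw [prod_rpow_neg_eq_mul_exp hd₀ he₀, ← mul_sub_one, abs_mul, abs_of_nonneg hprod]
    _ ≤ t ^ (-N) * (|w| * Real.exp |w|) :=
        mul_le_mul (prod_rpow_neg_le hg ht₀ fun i _ => hd i) (abs_exp_sub_one_le_abs_mul_exp w)
          (abs_nonneg _) (by positivity)
    _ ≤ t ^ (-N) * (N * (2 * R / t) * Real.exp N) := by gcongr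
    _ = 2 * N * Real.exp N * R * t ^ (-(N + 1)) := by
        rw [neg_add, Real.rpow_add ht₀, Real.rpow_neg_one]
        ring

end ProductsOfPowers

/-! ### Integrating a power against a measure of polynomial growth -/

section Tail

variable {α : Type*} [MeasurableSpace α] {μ : Measure α} {d : α → ℝ} {h : α → ℝ≥0∞} {N : ℝ}
  {X : ℝ≥0∞}

theorem lintegral_shell_rpow_le (hd : Measurable d) (hN : 0 ≤ N) {t : ℝ} (ht : 0 < t)
    (hgrowth : ∫⁻ y in {y | d y < 2 * t}, h y ∂μ ≤ ENNReal.ofReal ((2 * t) ^ N) * X) :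
    ∫⁻ y in {y | t ≤ d y ∧ d y < 2 * t}, ENNReal.ofReal (d y ^ (-(N + 1))) * h y ∂μ ≤
      ENNReal.ofReal (2 ^ N * t⁻¹) * X := by
  have hms : MeasurableSet {y | t ≤ d y ∧ d y < 2 * t} :=
    (measurableSet_le measurable_const hd).inter (measurableSet_lt hd measurable_const)
  calc ∫⁻ y in {y | t ≤ d y ∧ d y < 2 * t}, ENNReal.ofReal (d y ^ (-(N + 1))) * h y ∂μ
      ≤ ∫⁻ y in {y | t ≤ d y ∧ d y < 2 * t}, ENNReal.ofReal (t ^ (-(N + 1))) * h y ∂μ := by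
        refine setLIntegral_mono' hms fun y hy => ?_
        gcongr ENNReal.ofReal ?_ * _
        exact Real.rpow_le_rpow_of_nonpos ht hy.1 (by linarith)
    _ = ENNReal.ofReal (t ^ (-(N + 1))) *
          ∫⁻ y in {y | t ≤ d y ∧ d y < 2 * t}, h y ∂μ :=
        lintegral_const_mul' _ _ ENNReal.ofReal_ne_top
    _ ≤ ENNReal.ofReal (t ^ (-(N + 1))) * (ENNReal.ofReal ((2 * t) ^ N) * X) := by
        gcongr
        exact (lintegral_mono_set fun y hy => hy.2).trans hgrowth
    _ = ENNReal.ofReal (2 ^ N * t⁻¹) * X := by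
        rw [← mul_assoc, ← ENNReal.ofReal_mul (by positivity), Real.mul_rpow zero_le_two ht.le,
          neg_add, Real.rpow_add ht, Real.rpow_neg_one, Real.rpow_neg ht.le]
        congr 2
        field_simp

theorem lintegral_tail_rpow_le (hd : Measurable d) (hN : 0 ≤ N) {r : ℝ} (hr : 0 < r)
    (hgrowth : ∀ ρ, r ≤ ρ → ∫⁻ y in {y | d y < ρ}, h y ∂μ ≤ ENNReal.ofReal (ρ ^ N) * X) :
    ∫⁻ y in {y | r ≤ d y}, ENNReal.ofReal (d y ^ (-(N + 1))) * h y ∂μ ≤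
      ENNReal.ofReal (2 ^ (N + 1) * r⁻¹) * X := by
  set shell : ℕ → Set α := fun k => {y | 2 ^ k * r ≤ d y ∧ d y < 2 * (2 ^ k * r)}
  have hcover : {y | r ≤ d y} ⊆ ⋃ k, shell k := fun y hy => by
    obtain ⟨k, hlow, hupp⟩ := exists_nat_pow_near ((one_le_div hr).2 hy) one_lt_two
    rw [le_div_iff₀ hr] at hlow
    rw [div_lt_iff₀ hr, pow_succ', mul_assoc] at hupp
    exact Set.mem_iUnion.2 ⟨k, hlow, hupp⟩
  have hshell (k : ℕ) : ∫⁻ y in shell k, ENNReal.ofReal (d y ^ (-(N + 1))) * h y ∂μ ≤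
      ENNReal.ofReal (2 ^ N * r⁻¹) * X * ENNReal.ofReal ((1 / 2) ^ k) := by
    have hrk : r ≤ 2 * (2 ^ k * r) := by
      rw [← mul_assoc, ← pow_succ']
      exact le_mul_of_one_le_left hr.le (one_le_pow₀ one_le_two)
    refine (lintegral_shell_rpow_le hd hN (by positivity) (hgrowth _ hrk)).trans_eq ?_
    rw [mul_right_comm, ← ENNReal.ofReal_mul (by positivity), mul_inv, one_div, inv_pow]
    congr 2
    ring
  calc ∫⁻ y in {y | r ≤ d y}, ENNReal.ofReal (d y ^ (-(N + 1))) * h y ∂μ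
      ≤ ∑' k, ∫⁻ y in shell k, ENNReal.ofReal (d y ^ (-(N + 1))) * h y ∂μ :=
        (lintegral_mono_set hcover).trans (lintegral_iUnion_le _ _)
    _ ≤ ∑' k : ℕ, ENNReal.ofReal (2 ^ N * r⁻¹) * X * ENNReal.ofReal ((1 / 2) ^ k) :=
        ENNReal.tsum_le_tsum hshell
    _ = ENNReal.ofReal (2 ^ N * r⁻¹) * X * ENNReal.ofReal 2 := by
        rw [ENNReal.tsum_mul_left, ← ENNReal.ofReal_tsum_of_nonneg (fun k => by positivity)
          summable_geometric_two, tsum_geometric_two]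
    _ = _ := by
        rw [mul_right_comm, ← ENNReal.ofReal_mul (by positivity), Real.rpow_add_one two_ne_zero]
        congr 2
        ring

end Tail

/-! ### Cubes -/

section Cubes

variable {n : ℕ}

/-- The closed axis-parallel cube with lower corner `a` and side `l`; every `IsCube` is of this
form. -/
def cube (a : EuclideanSpace ℝ (Fin n)) (l : ℝ) : Set (EuclideanSpace ℝ (Fin n)) :=
  {y | ∀ j, a j ≤ y j ∧ y j ≤ a j + l}

theorem cube_eq_preimage_Icc (a : EuclideanSpace ℝ (Fin n)) (l : ℝ) :
    cube a l = (@WithLp.ofLp 2 (Fin n → ℝ)) ⁻¹' Set.Icc (fun j => a j) (fun j => a j + l) := by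
  ext y
  simp [cube, Pi.le_def, forall_and]

theorem volume_cube (a : EuclideanSpace ℝ (Fin n)) {l : ℝ} (hl : 0 ≤ l) :
    volume (cube a l) = ENNReal.ofReal (l ^ n) := by
  rw [cube_eq_preimage_Icc, (PiLp.volume_preserving_ofLp (Fin n)).measure_preimage
    measurableSet_Icc.nullMeasurableSet, Real.volume_Icc_pi]
  simp [ENNReal.ofReal_pow hl]

theorem volume_cube_pos (a : EuclideanSpace ℝ (Fin n)) {l : ℝ} (hl : 0 < l) :
    0 < volume (cube a l) := by
  rw [volume_cube a hl.le, ENNReal.ofReal_pos]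
  positivity

theorem volume_cube_ne_top (a : EuclideanSpace ℝ (Fin n)) {l : ℝ} (hl : 0 ≤ l) :
    volume (cube a l) ≠ ∞ := by
  rw [volume_cube a hl]
  exact ENNReal.ofReal_ne_top

theorem norm_sub_le_of_mem_cube {a x y : EuclideanSpace ℝ (Fin n)} {l : ℝ} (hl : 0 ≤ l)
    (hx : x ∈ cube a l) (hy : y ∈ cube a l) : ‖x - y‖ ≤ √n * l := by
  have hcoord (j : Fin n) : ‖(x - y) j‖ ≤ l := by
    rw [PiLp.sub_apply, Real.norm_eq_abs, abs_le]
    constructor <;> linarith [hx j, hy j]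
  calc ‖x - y‖ = √(∑ j, ‖(x - y) j‖ ^ 2) := EuclideanSpace.norm_eq _
    _ ≤ √(∑ _j : Fin n, l ^ 2) := by gcongr with j; exact hcoord j
    _ = √n * l := by simp [Real.sqrt_sq hl]

/-- The cube with centre `b` and side `2 * r`, the smallest cube around a ball. -/
def centredCube (b : EuclideanSpace ℝ (Fin n)) (r : ℝ) : Set (EuclideanSpace ℝ (Fin n)) :=
  cube (WithLp.toLp 2 fun j => b j - r) (2 * r)

theorem isCube_centredCube (b : EuclideanSpace ℝ (Fin n)) {r : ℝ} (hr : 0 < r) :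
    IsCube (centredCube b r) :=
  ⟨_, 2 * r, by positivity, rfl⟩

theorem volume_centredCube (b : EuclideanSpace ℝ (Fin n)) {r : ℝ} (hr : 0 ≤ r) :
    volume (centredCube b r) = ENNReal.ofReal ((2 * r) ^ n) :=
  volume_cube _ (by positivity)

theorem closedBall_subset_centredCube (b : EuclideanSpace ℝ (Fin n)) (r : ℝ) :
    Metric.closedBall b r ⊆ centredCube b r := fun y hy j => by
  have hj : ‖(y - b) j‖ ≤ r :=
    (PiLp.norm_apply_le (y - b) j).trans (mem_closedBall_iff_norm.1 hy)
  rw [PiLp.sub_apply, Real.norm_eq_abs, abs_le] at hj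
  constructor <;> simp only <;> linarith [hj.1, hj.2]

theorem volume_ball_le (b : EuclideanSpace ℝ (Fin n)) {r : ℝ} (hr : 0 ≤ r) :
    volume (Metric.ball b r) ≤ ENNReal.ofReal ((2 * r) ^ n) :=
  (measure_mono (Metric.ball_subset_closedBall.trans (closedBall_subset_centredCube b r))).trans_eq
    (volume_centredCube b hr)

end Cubes

/-! ### Finite families of linear maps -/

section LinearMaps

variable {ι E F : Type*} [Finite ι] [NormedAddCommGroup E] [NormedSpace ℝ E]
  [FiniteDimensional ℝ E] [NormedAddCommGroup F] [NormedSpace ℝ F]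

theorem exists_norm_linearMap_le (L : ι → E →ₗ[ℝ] F) :
    ∃ B : ℝ, 0 < B ∧ ∀ i y, ‖L i y‖ ≤ B * ‖y‖ := by
  obtain ⟨B, hB⟩ := Finite.exists_le fun i => ‖(L i).toContinuousLinearMap‖
  refine ⟨max B 1, by positivity, fun i y => ?_⟩
  exact ((L i).toContinuousLinearMap.le_opNorm y).trans
    (by gcongr; exact (hB i).trans (le_max_left B 1))

theorem exists_norm_le_of_injective (L : ι → E →ₗ[ℝ] F) (hL : ∀ i, Function.Injective (L i)) :
    ∃ K : ℝ, 0 < K ∧ ∀ i y, ‖y‖ ≤ K * ‖L i y‖ := by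
  choose K _ hK using fun i =>
    (L i).exists_antilipschitzWith (LinearMap.ker_eq_bot.2 (hL i))
  obtain ⟨K₀, hK₀⟩ := Finite.exists_le fun i => (K i : ℝ)
  refine ⟨max K₀ 1, by positivity, fun i y => ?_⟩
  exact (ZeroHomClass.bound_of_antilipschitz (L i) (hK i) y).trans
    (by gcongr; exact (hK₀ i).trans (le_max_left K₀ 1))

theorem exists_mul_norm_le_max_norm_sub (L : ι → E →ₗ[ℝ] F)
    (hL : ∀ i j, i ≠ j → Function.Injective (L i - L j)) :
    ∃ κ : ℝ, 0 < κ ∧ ∀ x y i j, i ≠ j → κ * ‖x‖ ≤ max ‖x - L i y‖ ‖x - L j y‖ := by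
  obtain ⟨B, hB, hLB⟩ := exists_norm_linearMap_le L
  obtain ⟨K, hK, hLK⟩ := exists_norm_le_of_injective
    (fun p : {p : ι × ι // p.1 ≠ p.2} => L p.1.1 - L p.1.2) fun p => hL _ _ p.2
  refine ⟨(1 + 2 * B * K)⁻¹, by positivity, fun x y i j hij => ?_⟩
  set t := max ‖x - L i y‖ ‖x - L j y‖
  have hdiff : ‖(L i - L j) y‖ ≤ 2 * t := by
    calc ‖(L i - L j) y‖ = ‖(x - L j y) - (x - L i y)‖ := by
          rw [LinearMap.sub_apply, sub_sub_sub_cancel_left]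
      _ ≤ ‖x - L j y‖ + ‖x - L i y‖ := norm_sub_le _ _
      _ ≤ t + t := add_le_add (le_max_right _ _) (le_max_left _ _)
      _ = 2 * t := (two_mul t).symm
  rw [inv_mul_le_iff₀ (by positivity)]
  calc ‖x‖ ≤ ‖x - L i y‖ + ‖L i y‖ := norm_le_norm_sub_add x (L i y)
    _ ≤ t + B * (K * (2 * t)) := by
        refine add_le_add (le_max_left _ _) ((hLB i y).trans ?_)
        gcongr
        exact (hLK ⟨(i, j), hij⟩ y).trans (by gcongr)
    _ = (1 + 2 * B * K) * t := by ring

end LinearMaps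

theorem toEuclideanLin_inv_apply_self {n : ℕ} {M : Matrix (Fin n) (Fin n) ℝ} (hM : IsUnit M)
    (y : EuclideanSpace ℝ (Fin n)) :
    Matrix.toEuclideanLin M⁻¹ (Matrix.toEuclideanLin M y) = y := by
  have h := LinearMap.congr_fun (Matrix.toLpLin_mul_same 2 M⁻¹ M) y
  rw [Matrix.nonsing_inv_mul _ ((Matrix.isUnit_iff_isUnit_det M).1 hM),
    Matrix.toLpLin_one] at h
  exact h.symm

theorem injective_toEuclideanLin {n : ℕ} {M : Matrix (Fin n) (Fin n) ℝ} (hM : IsUnit M) :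
    Function.Injective (Matrix.toEuclideanLin M) :=
  Function.LeftInverse.injective (toEuclideanLin_inv_apply_self hM)

theorem continuous_norm_sub_toEuclideanLin {n : ℕ} (M : Matrix (Fin n) (Fin n) ℝ) :
    Continuous fun p : EuclideanSpace ℝ (Fin n) × EuclideanSpace ℝ (Fin n) =>
      ‖p.1 - Matrix.toEuclideanLin M p.2‖ :=
  (continuous_fst.sub ((LinearMap.continuous_of_finiteDimensional _).comp continuous_snd)).norm

/-! ### The fractional maximal function -/

section FracMax

variable {n : ℕ}

theorem setLIntegral_closedBall_le_fracMax (γ : ℝ) (f : EuclideanSpace ℝ (Fin n) → ℝ)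
    {b z : EuclideanSpace ℝ (Fin n)} {r : ℝ} (hr : 0 < r) (hz : z ∈ Metric.closedBall b r) :
    ∫⁻ y in Metric.closedBall b r, ‖f y‖ₑ ≤
      ENNReal.ofReal ((2 * r) ^ (n * (1 - γ))) * fracMax γ f z := by
  have hvol : (volume (centredCube b r)) ^ (γ - 1) =
      (ENNReal.ofReal ((2 * r) ^ (n * (1 - γ))))⁻¹ := by
    rw [volume_centredCube b hr.le, ENNReal.ofReal_rpow_of_pos (by positivity),
      ← ENNReal.ofReal_inv_of_pos (by positivity), ← Real.rpow_natCast,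
      ← Real.rpow_mul (by positivity), ← Real.rpow_neg (by positivity)]
    congr 2
    ring
  have hmax : (ENNReal.ofReal ((2 * r) ^ (n * (1 - γ))))⁻¹ *
      ∫⁻ y in centredCube b r, ‖f y‖ₑ ≤ fracMax γ f z := by
    rw [← hvol]
    exact le_iSup₂_of_le (centredCube b r) (isCube_centredCube b hr)
      (le_iSup_of_le (closedBall_subset_centredCube b r hz) le_rfl)
  refine (lintegral_mono_set (closedBall_subset_centredCube b r)).trans ?_
  exact (ENNReal.inv_mul_le_iff (ENNReal.ofReal_pos.2 (by positivity)).ne'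
    ENNReal.ofReal_ne_top).1 hmax

/-- The infimum over `Q` of the fractional maximal function of `f` precomposed with `M⁻¹`. -/
noncomputable def infFracMax (γ : ℝ) (f : EuclideanSpace ℝ (Fin n) → ℝ)
    (M : Matrix (Fin n) (Fin n) ℝ) (Q : Set (EuclideanSpace ℝ (Fin n))) : ℝ≥0∞ :=
  ⨅ y ∈ Q, fracMax γ f (Matrix.toEuclideanLin M⁻¹ y)

theorem setLIntegral_norm_sub_lt_le_infFracMax (γ : ℝ) (f : EuclideanSpace ℝ (Fin n) → ℝ)
    {M : Matrix (Fin n) (Fin n) ℝ} (hM : IsUnit M) {B : ℝ} (hB : 0 < B)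
    (hMB : ∀ y, ‖Matrix.toEuclideanLin M⁻¹ y‖ ≤ B * ‖y‖)
    {Q : Set (EuclideanSpace ℝ (Fin n))} {x₀ : EuclideanSpace ℝ (Fin n)} {ρ : ℝ} (hρ : 0 < ρ)
    (hQ : Q ⊆ Metric.closedBall x₀ ρ) :
    ∫⁻ y in {y | ‖x₀ - Matrix.toEuclideanLin M y‖ < ρ}, ‖f y‖ₑ ≤
      ENNReal.ofReal (ρ ^ (n * (1 - γ))) *
        (ENNReal.ofReal ((2 * B) ^ (n * (1 - γ))) * infFracMax γ f M Q) := by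
  have himage {z : EuclideanSpace ℝ (Fin n)} (hz : ‖z - x₀‖ ≤ ρ) :
      Matrix.toEuclideanLin M⁻¹ z ∈
        Metric.closedBall (Matrix.toEuclideanLin M⁻¹ x₀) (B * ρ) := by
    rw [mem_closedBall_iff_norm, ← map_sub]
    exact (hMB _).trans (by gcongr)
  have hsub : {y | ‖x₀ - Matrix.toEuclideanLin M y‖ < ρ} ⊆
      Metric.closedBall (Matrix.toEuclideanLin M⁻¹ x₀) (B * ρ) := fun y hy => by
    rw [← toEuclideanLin_inv_apply_self hM y]
    exact himage ((norm_sub_rev _ _).trans_le (le_of_lt hy))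
  have hconst : ENNReal.ofReal (ρ ^ (n * (1 - γ))) * ENNReal.ofReal ((2 * B) ^ (n * (1 - γ))) =
      ENNReal.ofReal ((2 * (B * ρ)) ^ (n * (1 - γ))) := by
    rw [← ENNReal.ofReal_mul (by positivity), ← Real.mul_rpow hρ.le (by positivity)]
    congr 2
    ring
  rw [← mul_assoc, hconst, ← ENNReal.inv_mul_le_iff (ENNReal.ofReal_pos.2 (by positivity)).ne'
    ENNReal.ofReal_ne_top]
  refine le_iInf₂ fun z hz => ?_
  rw [ENNReal.inv_mul_le_iff (ENNReal.ofReal_pos.2 (by positivity)).ne' ENNReal.ofReal_ne_top]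
  exact (lintegral_mono_set hsub).trans
    (setLIntegral_closedBall_le_fracMax γ f (by positivity)
      (himage (mem_closedBall_iff_norm.1 (hQ hz))))

end FracMax

/-! ### The kernel -/

section Kernel

variable {n m : ℕ} (A : Fin m → Matrix (Fin n) (Fin n) ℝ) (γs : Fin m → ℝ)

theorem homKernel_nonneg (x y : EuclideanSpace ℝ (Fin n)) : 0 ≤ homKernel A γs x y :=
  Finset.prod_nonneg fun _ _ => Real.rpow_nonneg (norm_nonneg _) _

theorem measurable_homKernel :
    Measurable fun p : EuclideanSpace ℝ (Fin n) × EuclideanSpace ℝ (Fin n) =>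
      homKernel A γs p.1 p.2 :=
  Finset.measurable_prod _ fun i _ =>
    (continuous_norm_sub_toEuclideanLin (A i)).measurable.pow_const _

theorem homKernel_eq_rpow_mul_prod_div {δ : ℝ} (hδ : 0 < δ) (x y : EuclideanSpace ℝ (Fin n)) :
    homKernel A γs x y =
      δ ^ (-∑ i, γs i) * ∏ i, (‖x - Matrix.toEuclideanLin (A i) y‖ / δ) ^ (-γs i) := by
  rw [← Finset.sum_neg_distrib, Real.rpow_sum_of_pos hδ, ← Finset.prod_mul_distrib]
  refine Finset.prod_congr rfl fun i _ => ?_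
  rw [← Real.mul_rpow hδ.le (by positivity), mul_div_cancel₀ _ hδ.ne']

variable {γs}

theorem setLIntegral_homKernel_le_of_separated (hγs : ∀ i, 0 ≤ γs i) {δ : ℝ} (hδ : 0 < δ)
    {S : Set (EuclideanSpace ℝ (Fin n))} {y : EuclideanSpace ℝ (Fin n)}
    (hsep : ∀ x ∈ S, ∀ i j, i ≠ j →
      δ ≤ max ‖x - Matrix.toEuclideanLin (A i) y‖ ‖x - Matrix.toEuclideanLin (A j) y‖) :
    ∫⁻ x in S, ENNReal.ofReal (homKernel A γs x y) ≤
      ENNReal.ofReal (δ ^ (-∑ i, γs i)) * (volume S + ∑ i, (ENNReal.ofReal (δ ^ n) *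
        (∫⁻ x in Metric.ball (0 : EuclideanSpace ℝ (Fin n)) 1, ENNReal.ofReal (‖x‖ ^ (-γs i))) +
          volume S)) := by
  set d : Fin m → EuclideanSpace ℝ (Fin n) → ℝ :=
    fun i x => ‖x - Matrix.toEuclideanLin (A i) y‖ / δ
  have hpt : ∀ x ∈ S, ENNReal.ofReal (homKernel A γs x y) ≤
      ENNReal.ofReal (δ ^ (-∑ i, γs i)) * (1 + ∑ i, ENNReal.ofReal (d i x ^ (-γs i))) := by
    intro x hx
    have hle := prod_rpow_neg_le_one_add_sum (d := fun i => d i x) hγs (fun i => by positivity)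
      fun i j hij => by
        rw [max_div_div_right hδ.le, one_le_div hδ]
        exact hsep x hx i j hij
    rw [homKernel_eq_rpow_mul_prod_div A γs hδ, ENNReal.ofReal_mul (by positivity)]
    gcongr
    refine (ENNReal.ofReal_le_ofReal hle).trans_eq ?_
    rw [ENNReal.ofReal_add zero_le_one (by positivity), ENNReal.ofReal_one,
      ENNReal.ofReal_sum_of_nonneg fun i _ => by positivity]
  have hmeas (i : Fin m) : Measurable fun x => ENNReal.ofReal (d i x ^ (-γs i)) := by fun_prop
  calc ∫⁻ x in S, ENNReal.ofReal (homKernel A γs x y)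
      ≤ ∫⁻ x in S, ENNReal.ofReal (δ ^ (-∑ i, γs i)) *
          (1 + ∑ i, ENNReal.ofReal (d i x ^ (-γs i))) := setLIntegral_mono (by fun_prop) hpt
    _ = ENNReal.ofReal (δ ^ (-∑ i, γs i)) *
          (volume S + ∑ i, ∫⁻ x in S, ENNReal.ofReal (d i x ^ (-γs i))) := by
        rw [lintegral_const_mul' _ _ ENNReal.ofReal_ne_top, lintegral_add_left measurable_const,
          setLIntegral_one, lintegral_finsetSum _ fun i _ => hmeas i]
    _ ≤ _ := by
        gcongr with i
        simpa only [finrank_euclideanSpace, Fintype.card_fin] using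
          setLIntegral_norm_sub_div_rpow_le volume (hγs i) S (Matrix.toEuclideanLin (A i) y) hδ

variable {A}

theorem exists_setLIntegral_homKernel_le (hAA : ∀ k k', k ≠ k' → IsUnit (A k - A k'))
    (hγs : ∀ i, 0 ≤ γs i) (hγn : ∀ i, γs i < n) {ε : ℝ} (hε : 0 < ε) :
    ∃ C : ℝ≥0, ∀ (a y : EuclideanSpace ℝ (Fin n)) (l : ℝ), 0 < l →
      ∫⁻ x in cube a l \ Metric.ball 0 (ε * l), ENNReal.ofReal (homKernel A γs x y) ≤
        C * (ENNReal.ofReal (l ^ (-∑ i, γs i)) * volume (cube a l)) := by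
  obtain ⟨κ, hκ, hsep⟩ := exists_mul_norm_le_max_norm_sub
    (fun i => Matrix.toEuclideanLin (A i)) fun i j hij => by
      rw [← map_sub]
      exact injective_toEuclideanLin (hAA i j hij)
  set N := ∑ i, γs i
  set J : Fin m → ℝ≥0∞ := fun i =>
    ∫⁻ x in Metric.ball (0 : EuclideanSpace ℝ (Fin n)) 1, ENNReal.ofReal (‖x‖ ^ (-γs i))
  have hJ (i : Fin m) : J i ≠ ∞ := (lintegral_ball_norm_rpow_lt_top volume (hγs i)
    (by simpa using hγn i) 1).ne
  set C : ℝ≥0∞ := ENNReal.ofReal ((κ * ε) ^ (-N)) *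
    (1 + ∑ i, (ENNReal.ofReal ((κ * ε) ^ n) * J i + 1))
  have hC : C ≠ ∞ := by simp [C, hJ, ENNReal.mul_eq_top]
  refine ⟨C.toNNReal, fun a y l hl => ?_⟩
  rw [ENNReal.coe_toNNReal hC]
  have hvol : volume (cube a l \ Metric.ball 0 (ε * l)) ≤ volume (cube a l) :=
    measure_mono Set.sdiff_subset
  calc ∫⁻ x in cube a l \ Metric.ball 0 (ε * l), ENNReal.ofReal (homKernel A γs x y)
      ≤ ENNReal.ofReal ((κ * ε * l) ^ (-N)) * (volume (cube a l) +
          ∑ i, (ENNReal.ofReal ((κ * ε * l) ^ n) * J i + volume (cube a l))) := by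
        refine (setLIntegral_homKernel_le_of_separated A hγs (δ := κ * ε * l) (by positivity)
          fun x hx i j hij => le_trans ?_ (hsep x y i j hij)).trans (by gcongr)
        rw [mul_assoc]
        gcongr
        simpa using hx.2
    _ = _ := by
        have hscale : ENNReal.ofReal ((κ * ε * l) ^ n) =
            ENNReal.ofReal ((κ * ε) ^ n) * volume (cube a l) := by
          rw [volume_cube a hl.le, ← ENNReal.ofReal_mul (by positivity), mul_pow]
        rw [hscale, Real.mul_rpow (by positivity) hl.le, ENNReal.ofReal_mul (by positivity)]
        simp only [C, Finset.sum_add_distrib, Finset.sum_const, mul_right_comm _ (volume _),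
          ← Finset.sum_mul, nsmul_eq_mul]
        ring

end Kernel

/-! ### Splitting the operator -/

section Operator

variable {n m : ℕ} {A : Fin m → Matrix (Fin n) (Fin n) ℝ} {γs : Fin m → ℝ}

variable (A) in
/-- The points mapped by some `A i` into the ball of radius `r` around `x₀`, i.e. those close to
the singularities of the kernel `homKernel A γs x₀`. -/
def nearSet (x₀ : EuclideanSpace ℝ (Fin n)) (r : ℝ) : Set (EuclideanSpace ℝ (Fin n)) :=
  ⋃ i, {y | ‖x₀ - Matrix.toEuclideanLin (A i) y‖ < r}

theorem measurable_norm_sub_toEuclideanLin (M : Matrix (Fin n) (Fin n) ℝ)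
    (x₀ : EuclideanSpace ℝ (Fin n)) : Measurable fun y => ‖x₀ - Matrix.toEuclideanLin M y‖ :=
  ((continuous_norm_sub_toEuclideanLin M).comp (Continuous.prodMk_right x₀)).measurable

theorem measurableSet_nearSet (x₀ : EuclideanSpace ℝ (Fin n)) (r : ℝ) :
    MeasurableSet (nearSet A x₀ r) :=
  MeasurableSet.iUnion fun i =>
    measurableSet_lt (measurable_norm_sub_toEuclideanLin (A i) x₀) measurable_const

theorem le_norm_sub_of_notMem_nearSet {x₀ y : EuclideanSpace ℝ (Fin n)} {r : ℝ}
    (hy : y ∉ nearSet A x₀ r) (i : Fin m) : r ≤ ‖x₀ - Matrix.toEuclideanLin (A i) y‖ :=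
  not_lt.1 fun hlt => hy (Set.mem_iUnion.2 ⟨i, hlt⟩)

theorem setLIntegral_nearSet_le {h : EuclideanSpace ℝ (Fin n) → ℝ≥0∞}
    {x₀ : EuclideanSpace ℝ (Fin n)} {r : ℝ} {c : ℝ≥0∞} {Y : Fin m → ℝ≥0∞}
    (hY : ∀ i, ∫⁻ y in {y | ‖x₀ - Matrix.toEuclideanLin (A i) y‖ < r}, h y ≤ c * Y i) :
    ∫⁻ y in nearSet A x₀ r, h y ≤ c * ∑ i, Y i := by
  rw [Finset.mul_sum, ← tsum_fintype (L := .unconditional _)]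
  exact (lintegral_iUnion_le _ _).trans (ENNReal.tsum_le_tsum hY)

theorem abs_homKernel_sub_le (hγs : ∀ i, 0 ≤ γs i) {x x₀ y : EuclideanSpace ℝ (Fin n)} {R : ℝ}
    (hR : 0 < R) (hx : ‖x - x₀‖ ≤ R) (hy : y ∉ nearSet A x₀ (2 * R)) :
    |homKernel A γs x y - homKernel A γs x₀ y| ≤
      2 * (∑ i, γs i) * Real.exp (∑ i, γs i) * R *
        ∑ i, ‖x₀ - Matrix.toEuclideanLin (A i) y‖ ^ (-(∑ i, γs i + 1)) := by
  cases isEmpty_or_nonempty (Fin m)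
  · simp [homKernel]
  obtain ⟨k, hk⟩ := Finite.exists_min fun i => ‖x₀ - Matrix.toEuclideanLin (A i) y‖
  refine (abs_prod_rpow_neg_sub_le hγs hR (le_norm_sub_of_notMem_nearSet hy k) hk fun i =>
    (abs_norm_sub_norm_le _ _).trans (by simpa using hx)).trans ?_
  have hN : 0 ≤ ∑ i, γs i := Finset.sum_nonneg fun i _ => hγs i
  gcongr
  exact Finset.single_le_sum
    (f := fun i => ‖x₀ - Matrix.toEuclideanLin (A i) y‖ ^ (-(∑ i, γs i + 1)))
    (fun i _ => by positivity) (Finset.mem_univ k)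

theorem setLIntegral_compl_nearSet_le (hγs : ∀ i, 0 ≤ γs i)
    {h : EuclideanSpace ℝ (Fin n) → ℝ≥0∞} (hh : AEMeasurable h)
    {x x₀ : EuclideanSpace ℝ (Fin n)} {R : ℝ} (hR : 0 < R) (hx : ‖x - x₀‖ ≤ R)
    {Y : Fin m → ℝ≥0∞}
    (hY : ∀ i ρ, 2 * R ≤ ρ → ∫⁻ y in {y | ‖x₀ - Matrix.toEuclideanLin (A i) y‖ < ρ}, h y ≤
      ENNReal.ofReal (ρ ^ ∑ i, γs i) * Y i) :
    ∫⁻ y in (nearSet A x₀ (2 * R))ᶜ, ‖homKernel A γs x y - homKernel A γs x₀ y‖ₑ * h y ≤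
      ENNReal.ofReal ((∑ i, γs i) * Real.exp (∑ i, γs i) * 2 ^ (∑ i, γs i + 1)) *
        ∑ i, Y i := by
  set N := ∑ i, γs i
  have hN : 0 ≤ N := Finset.sum_nonneg fun i _ => hγs i
  set d : Fin m → EuclideanSpace ℝ (Fin n) → ℝ :=
    fun i y => ‖x₀ - Matrix.toEuclideanLin (A i) y‖
  have hd (i : Fin m) : Measurable (d i) := measurable_norm_sub_toEuclideanLin (A i) x₀
  have htail (i : Fin m) : ∫⁻ y in (nearSet A x₀ (2 * R))ᶜ,
      ENNReal.ofReal (d i y ^ (-(N + 1))) * h y ≤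
        ENNReal.ofReal (2 ^ (N + 1) * (2 * R)⁻¹) * Y i :=
    (lintegral_mono_set fun y hy => le_norm_sub_of_notMem_nearSet hy i).trans
      (lintegral_tail_rpow_le (hd i) hN (by positivity) (hY i))
  calc ∫⁻ y in (nearSet A x₀ (2 * R))ᶜ, ‖homKernel A γs x y - homKernel A γs x₀ y‖ₑ * h y
      ≤ ∫⁻ y in (nearSet A x₀ (2 * R))ᶜ, ENNReal.ofReal (2 * N * Real.exp N * R) *
          ∑ i, ENNReal.ofReal (d i y ^ (-(N + 1))) * h y := by
        refine setLIntegral_mono' (measurableSet_nearSet x₀ _).compl fun y hy => ?_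
        rw [← Finset.sum_mul, ← mul_assoc, ← ENNReal.ofReal_sum_of_nonneg fun i _ => by positivity,
          ← ENNReal.ofReal_mul (by positivity), Real.enorm_eq_ofReal_abs]
        gcongr
        exact abs_homKernel_sub_le hγs hR hx hy
    _ = ENNReal.ofReal (2 * N * Real.exp N * R) * ∑ i, ∫⁻ y in (nearSet A x₀ (2 * R))ᶜ,
          ENNReal.ofReal (d i y ^ (-(N + 1))) * h y := by
        rw [lintegral_const_mul' _ _ ENNReal.ofReal_ne_top, lintegral_finsetSum' _ fun i _ => ?_]
        exact ((hd i).pow_const _).ennreal_ofReal.aemeasurable.mul hh.restrict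
    _ ≤ ENNReal.ofReal (2 * N * Real.exp N * R) *
          ∑ i, ENNReal.ofReal (2 ^ (N + 1) * (2 * R)⁻¹) * Y i := by
        gcongr with i
        exact htail i
    _ = _ := by
        rw [← Finset.mul_sum, ← mul_assoc, ← ENNReal.ofReal_mul (by positivity)]
        congr 2
        field_simp

variable {f : EuclideanSpace ℝ (Fin n) → ℝ}

theorem enorm_homOp_sub_setIntegral_compl_le {x x₀ : EuclideanSpace ℝ (Fin n)}
    (hx : Integrable fun y => homKernel A γs x y * f y)
    (hx₀ : Integrable fun y => homKernel A γs x₀ y * f y)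
    {S : Set (EuclideanSpace ℝ (Fin n))} (hS : MeasurableSet S) :
    ‖homOp A γs f x - ∫ y in Sᶜ, homKernel A γs x₀ y * f y‖ₑ ≤
      (∫⁻ y in S, ENNReal.ofReal (homKernel A γs x y) * ‖f y‖ₑ) +
        ∫⁻ y in Sᶜ, ‖homKernel A γs x y - homKernel A γs x₀ y‖ₑ * ‖f y‖ₑ := by
  have hsplit : homOp A γs f x - ∫ y in Sᶜ, homKernel A γs x₀ y * f y =
      (∫ y in S, homKernel A γs x y * f y) +
        ∫ y in Sᶜ, (homKernel A γs x y - homKernel A γs x₀ y) * f y := by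
    simp_rw [sub_mul]
    rw [homOp, ← integral_add_compl hS hx, integral_sub hx.restrict hx₀.restrict, add_sub_assoc]
  calc _ ≤ ‖∫ y in S, homKernel A γs x y * f y‖ₑ +
        ‖∫ y in Sᶜ, (homKernel A γs x y - homKernel A γs x₀ y) * f y‖ₑ := by
        rw [hsplit]
        exact enorm_add_le _ _
    _ ≤ (∫⁻ y in S, ‖homKernel A γs x y * f y‖ₑ) +
        ∫⁻ y in Sᶜ, ‖(homKernel A γs x y - homKernel A γs x₀ y) * f y‖ₑ :=
        add_le_add (enorm_integral_le_lintegral_enorm _) (enorm_integral_le_lintegral_enorm _)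
    _ = _ := by simp only [enorm_mul, Real.enorm_eq_ofReal (homKernel_nonneg A γs x _)]

theorem aemeasurable_homKernel_mul (hf : AEMeasurable f)
    (S T : Set (EuclideanSpace ℝ (Fin n))) :
    AEMeasurable (Function.uncurry fun x y => ENNReal.ofReal (homKernel A γs x y) * ‖f y‖ₑ)
      ((volume.restrict T).prod (volume.restrict S)) :=
  (measurable_homKernel A γs).ennreal_ofReal.aemeasurable.mul hf.enorm.restrict.comp_snd

theorem lintegral_lintegral_homKernel_mul_le (hf : AEMeasurable f)
    (S T : Set (EuclideanSpace ℝ (Fin n))) {K : ℝ≥0∞}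
    (hK : ∀ y, ∫⁻ x in T, ENNReal.ofReal (homKernel A γs x y) ≤ K) :
    ∫⁻ x in T, ∫⁻ y in S, ENNReal.ofReal (homKernel A γs x y) * ‖f y‖ₑ ≤
      K * ∫⁻ y in S, ‖f y‖ₑ := by
  rw [lintegral_lintegral_swap (aemeasurable_homKernel_mul hf S T),
    ← lintegral_const_mul'' _ hf.enorm.restrict]
  refine lintegral_mono fun y => ?_
  rw [lintegral_mul_const' _ _ enorm_ne_top]
  gcongr
  exact hK y

end Operator

/-! ### Bounding the local mean oscillation -/

section MedianOsc

variable {n : ℕ} {s : ℝ} {g : EuclideanSpace ℝ (Fin n) → ℝ}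

theorem medianOsc_le_of_forall_gt {Q : Set (EuclideanSpace ℝ (Fin n))} (c : ℝ) {b : ℝ≥0∞}
    (h : ∀ α : ℝ≥0, b < α →
      volume {y | y ∈ Q ∧ (α : ℝ) < |g y - c|} < ENNReal.ofReal s * volume Q) :
    medianOsc s g Q ≤ b := by
  refine le_of_forall_gt fun t ht => ?_
  obtain ⟨α, hbα, hαt⟩ := ENNReal.lt_iff_exists_nnreal_btwn.1 ht
  exact (iInf₂_le_of_le c α (iInf_le_of_le (h α hbα) le_rfl)).trans_lt hαt

theorem medianOsc_le_of_lintegral_le (hs : 0 < s) {Q W : Set (EuclideanSpace ℝ (Fin n))}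
    (hQ : volume Q ≠ 0) (hQ' : volume Q ≠ ∞)
    (hW : volume W ≤ ENNReal.ofReal (s / 4) * volume Q) (c : ℝ)
    {U : EuclideanSpace ℝ (Fin n) → ℝ≥0∞} (hU : AEMeasurable U (volume.restrict (Q \ W)))
    {a b : ℝ≥0∞} (hUa : ∫⁻ x in Q \ W, U x ≤ ENNReal.ofReal (s / 4) * volume Q * a)
    (hg : ∀ᵐ x, x ∈ Q → x ∉ W → ‖g x - c‖ₑ ≤ U x + b) :
    medianOsc s g Q ≤ a + b := by
  refine medianOsc_le_of_forall_gt c fun α hα => ?_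
  set V := ENNReal.ofReal (s / 4) * volume Q
  have ha : a < α - b := lt_tsub_iff_right.2 hα
  have hmarkov : volume.restrict (Q \ W) {x | (α : ℝ≥0∞) - b ≤ U x} ≤ V := by
    have hle := (mul_meas_ge_le_lintegral₀ hU (α - b)).trans (hUa.trans
      (mul_le_mul_right ha.le V))
    rw [mul_comm] at hle
    exact (ENNReal.mul_le_mul_iff_left (pos_of_gt ha).ne' (by finiteness)).1 hle
  have hsub : ({y | y ∈ Q ∧ (α : ℝ) < |g y - c|} : Set _) ≤ᵐ[volume]
      (W ∪ {x | (α : ℝ≥0∞) - b ≤ U x} ∩ (Q \ W) : Set _) := by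
    filter_upwards [hg] with x hx ⟨hxQ, hxα⟩
    refine or_iff_not_imp_left.2 fun hxW => ⟨?_, hxQ, hxW⟩
    have hα : (α : ℝ≥0∞) < ‖g x - c‖ₑ := by
      rw [enorm_eq_nnnorm]
      exact_mod_cast hxα
    exact tsub_le_iff_right.2 (hα.le.trans (hx hxQ hxW))
  calc volume {y | y ∈ Q ∧ (α : ℝ) < |g y - c|}
      ≤ volume W + volume ({x | (α : ℝ≥0∞) - b ≤ U x} ∩ (Q \ W)) :=
        (measure_mono_ae hsub).trans (measure_union_le _ _)
    _ ≤ V + V := add_le_add hW ((Measure.le_restrict_apply _ _).trans hmarkov)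
    _ < ENNReal.ofReal s * volume Q := by
        rw [← add_mul, ← ENNReal.ofReal_add (by positivity) (by positivity)]
        gcongr ?_ * _
        exact (ENNReal.ofReal_lt_ofReal_iff hs).2 (by linarith)

theorem localSharp_le_mul_sum_iSup {ι : Type*} [Fintype ι] {c : ℝ≥0∞}
    {F : ι → Set (EuclideanSpace ℝ (Fin n)) → ℝ≥0∞}
    (h : ∀ Q, IsCube Q → medianOsc s g Q ≤ c * ∑ i, F i Q)
    (Q₀ : Set (EuclideanSpace ℝ (Fin n))) (x : EuclideanSpace ℝ (Fin n)) :
    localSharp s Q₀ g x ≤ c * ∑ i, ⨆ (Q : Set (EuclideanSpace ℝ (Fin n))) (_ : IsCube Q)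
      (_ : x ∈ Q) (_ : Q ⊆ Q₀), F i Q := by
  refine iSup₂_le fun Q hQ => iSup₂_le fun hxQ hQQ₀ => (h Q hQ).trans ?_
  gcongr with i
  exact le_iSup₂_of_le Q hQ (le_iSup₂_of_le hxQ hQQ₀ le_rfl)

end MedianOsc

/-! ### Integrable singularities -/

section Subcritical

variable {n m : ℕ} {A : Fin m → Matrix (Fin n) (Fin n) ℝ} {γs : Fin m → ℝ}
  {f : EuclideanSpace ℝ (Fin n) → ℝ}

theorem setLIntegral_setLIntegral_nearSet_le (hf : AEMeasurable f)
    {a x₀ : EuclideanSpace ℝ (Fin n)} {l : ℝ} (hl : 0 < l)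
    {T : Set (EuclideanSpace ℝ (Fin n))} {K : ℝ≥0∞}
    (hK : ∀ y, ∫⁻ x in T, ENNReal.ofReal (homKernel A γs x y) ≤
      K * (ENNReal.ofReal (l ^ (-∑ i, γs i)) * volume (cube a l)))
    {t : ℝ} (ht : 0 ≤ t) {Y : Fin m → ℝ≥0∞}
    (hY : ∀ i, ∫⁻ y in {y | ‖x₀ - Matrix.toEuclideanLin (A i) y‖ < t * l}, ‖f y‖ₑ ≤
      ENNReal.ofReal ((t * l) ^ ∑ i, γs i) * Y i) :
    ∫⁻ x in T, ∫⁻ y in nearSet A x₀ (t * l),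
        ENNReal.ofReal (homKernel A γs x y) * ‖f y‖ₑ ≤
      volume (cube a l) * (K * ENNReal.ofReal (t ^ ∑ i, γs i) * ∑ i, Y i) := by
  set N := ∑ i, γs i
  have hscale : ENNReal.ofReal (l ^ (-N)) * ENNReal.ofReal ((t * l) ^ N) =
      ENNReal.ofReal (t ^ N) := by
    rw [← ENNReal.ofReal_mul (by positivity), Real.mul_rpow ht hl.le, mul_left_comm,
      ← Real.rpow_add hl, neg_add_cancel, Real.rpow_zero, mul_one]
  calc _ ≤ K * (ENNReal.ofReal (l ^ (-N)) * volume (cube a l)) *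
        (ENNReal.ofReal ((t * l) ^ N) * ∑ i, Y i) :=
        (lintegral_lintegral_homKernel_mul_le hf _ T hK).trans
          (mul_le_mul_right (setLIntegral_nearSet_le hY) _)
    _ = _ := by
        rw [← hscale]
        ring

theorem medianOsc_homOp_le (hn : 0 < n) (hγs : ∀ i, 0 ≤ γs i) {s : ℝ} (hs : 0 < s)
    (hf : AEMeasurable f)
    (hint : ∀ᵐ x, Integrable fun y => homKernel A γs x y * f y)
    {a : EuclideanSpace ℝ (Fin n)} {l : ℝ} (hl : 0 < l)
    {W : Set (EuclideanSpace ℝ (Fin n))}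
    (hW : volume W ≤ ENNReal.ofReal (s / 4) * volume (cube a l)) {K : ℝ≥0∞}
    (hK : ∀ y, ∫⁻ x in cube a l \ W, ENNReal.ofReal (homKernel A γs x y) ≤
      K * (ENNReal.ofReal (l ^ (-∑ i, γs i)) * volume (cube a l)))
    {Y : Fin m → ℝ≥0∞}
    (hY : ∀ x₀ ∈ cube a l, ∀ i ρ, √n * l ≤ ρ →
      ∫⁻ y in {y | ‖x₀ - Matrix.toEuclideanLin (A i) y‖ < ρ}, ‖f y‖ₑ ≤
        ENNReal.ofReal (ρ ^ ∑ i, γs i) * Y i) :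
    medianOsc s (homOp A γs f) (cube a l) ≤
      (ENNReal.ofReal (4 / s) * K * ENNReal.ofReal ((2 * √n) ^ ∑ i, γs i) +
        ENNReal.ofReal ((∑ i, γs i) * Real.exp (∑ i, γs i) * 2 ^ (∑ i, γs i + 1))) *
          ∑ i, Y i := by
  set N := ∑ i, γs i
  have hR : 0 < √n * l := by positivity
  have hvol := (volume_cube_pos a hl).ne'
  obtain ⟨x₀, hx₀, hx₀int⟩ : ∃ x₀ ∈ cube a l, Integrable fun y => homKernel A γs x₀ y * f y :=
    ((frequently_ae_mem_iff.2 hvol).and_eventually hint).exists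
  have hnear := setLIntegral_setLIntegral_nearSet_le hf hl hK (x₀ := x₀) (t := 2 * √n)
    (by positivity) fun i => hY x₀ hx₀ i _ (by linarith)
  rw [mul_assoc 2] at hnear
  rw [add_mul]
  refine medianOsc_le_of_lintegral_le hs hvol (volume_cube_ne_top a hl.le) hW
    (∫ y in (nearSet A x₀ (2 * (√n * l)))ᶜ, homKernel A γs x₀ y * f y)
    (aemeasurable_homKernel_mul hf _ _).lintegral_prod_right' (hnear.trans_eq ?_) ?_
  · have hcancel : ENNReal.ofReal (s / 4) * ENNReal.ofReal (4 / s) = 1 := by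
      rw [← ENNReal.ofReal_mul (by positivity), div_mul_div_cancel₀ (by positivity)]
      simp [hs.ne']
    rw [← one_mul (volume _ * _), ← hcancel]
    ring
  · filter_upwards [hint] with x hx hxQ _
    refine (enorm_homOp_sub_setIntegral_compl_le hx hx₀int
      (measurableSet_nearSet x₀ (2 * (√n * l)))).trans (add_le_add_right ?_ _)
    exact setLIntegral_compl_nearSet_le hγs hf.enorm hR (norm_sub_le_of_mem_cube hl.le hxQ hx₀)
      fun i ρ hρ => hY x₀ hx₀ i ρ (by linarith)

theorem exists_medianOsc_homOp_le_of_lt (hn : 0 < n) (hA : ∀ i, IsUnit (A i))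
    (hAA : ∀ k k', k ≠ k' → IsUnit (A k - A k')) (hγs : ∀ i, 0 ≤ γs i)
    (hγn : ∀ i, γs i < n) {γ : ℝ} (hsum : ∑ i, γs i = n * (1 - γ)) {s : ℝ} (hs : 0 < s) :
    ∃ c : ℝ≥0, ∀ f : EuclideanSpace ℝ (Fin n) → ℝ, AEMeasurable f →
      (∀ᵐ x, Integrable fun y => homKernel A γs x y * f y) →
      ∀ Q, IsCube Q → medianOsc s (homOp A γs f) Q ≤ c * ∑ i, infFracMax γ f (A i) Q := by
  obtain ⟨B, hB, hMB⟩ := exists_norm_linearMap_le fun i => Matrix.toEuclideanLin (A i)⁻¹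
  set ε := (s / 4) ^ (n : ℝ)⁻¹ / 2
  have hε : 0 < ε := by positivity
  obtain ⟨K, hK⟩ := exists_setLIntegral_homKernel_le hAA hγs hγn hε
  set N := ∑ i, γs i
  refine ⟨((4 / s).toNNReal * K * ((2 * √n) ^ N).toNNReal +
    (N * Real.exp N * 2 ^ (N + 1)).toNNReal) * ((2 * B) ^ N).toNNReal, fun f hf hint Q hQ => ?_⟩
  obtain ⟨a, l, hl, rfl⟩ := hQ
  have hW : volume (Metric.ball (0 : EuclideanSpace ℝ (Fin n)) (ε * l)) ≤
      ENNReal.ofReal (s / 4) * volume (cube a l) := by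
    refine (volume_ball_le 0 (by positivity)).trans_eq ?_
    rw [volume_cube a hl.le, ← ENNReal.ofReal_mul (by positivity), ← mul_assoc, mul_pow,
      mul_div_cancel₀ _ two_ne_zero, Real.rpow_inv_natCast_pow (by positivity) hn.ne']
  have hosc := medianOsc_homOp_le hn hγs hs hf hint hl hW (hK a · l hl)
    (Y := fun i => ENNReal.ofReal ((2 * B) ^ N) * infFracMax γ f (A i) (cube a l))
    fun x₀ hx₀ i ρ hρ => by
      simp only [N, hsum]
      exact setLIntegral_norm_sub_lt_le_infFracMax γ f (hA i) hB (hMB i)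
        ((by positivity : 0 < √n * l).trans_le hρ) fun y hy =>
          mem_closedBall_iff_norm.2 ((norm_sub_le_of_mem_cube hl.le hy hx₀).trans hρ)
  refine hosc.trans_eq ?_
  rw [← Finset.mul_sum, ← mul_assoc]
  rfl

end Subcritical

/-! ### Non-integrable singularities -/

section LebesguePoints

open Module Filter Topology Metric

theorem tendsto_measure_closedBall_nhdsGT_zero {X : Type*} [MetricSpace X] [ProperSpace X]
    [MeasurableSpace X] [OpensMeasurableSpace X] (ν : Measure X) [IsFiniteMeasureOnCompacts ν]
    [NullSingletonClass ν] (x : X) :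
    Tendsto (fun δ => ν (closedBall x δ)) (𝓝[>] 0) (𝓝 0) := by
  have h := tendsto_measure_biInter_gt (μ := ν) (s := closedBall x) (a := (0 : ℝ))
    (fun _ _ => measurableSet_closedBall.nullMeasurableSet)
    (fun _ _ _ hij => closedBall_subset_closedBall hij) ⟨1, one_pos, measure_closedBall_lt_top.ne⟩
  rwa [biInter_gt_closedBall, closedBall_zero, measure_singleton] at h

variable {E F : Type*} [NormedAddCommGroup E] [NormedSpace ℝ E] [FiniteDimensional ℝ E]
  [MeasurableSpace E] [BorelSpace E] (μ : Measure E) [μ.IsAddHaarMeasure]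
  [NormedAddCommGroup F] [NormedSpace ℝ F] {f : E → F}

theorem norm_setAverage_closedBall_le {g : E → ℝ} (hg : Integrable g μ) {z : E} {δ : ℝ}
    (hδ : 0 < δ)
    (hfg : ∀ᵐ y ∂μ, y ∈ closedBall z δ → ‖f y‖ ≤ ‖z - y‖ ^ finrank ℝ E * ‖g y‖) :
    ‖⨍ y in closedBall z δ, f y ∂μ‖ ≤
      (μ.real (ball 0 1))⁻¹ * ∫ y in closedBall z δ, ‖g y‖ ∂μ := by
  have hle : ∀ᵐ y ∂μ.restrict (closedBall z δ), ‖f y‖ ≤ δ ^ finrank ℝ E * ‖g y‖ := by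
    filter_upwards [ae_restrict_mem measurableSet_closedBall, ae_restrict_of_ae hfg] with y hy hf
    refine (hf hy).trans ?_
    gcongr
    exact mem_closedBall_iff_norm'.1 hy
  rw [setAverage_eq, norm_smul, norm_inv, Measure.addHaar_real_closedBall _ _ hδ.le,
    Real.norm_of_nonneg (by positivity)]
  calc _ ≤ (δ ^ finrank ℝ E * μ.real (ball 0 1))⁻¹ *
        ∫ y in closedBall z δ, δ ^ finrank ℝ E * ‖g y‖ ∂μ := by
        gcongr
        exact norm_integral_le_of_norm_le (hg.norm.const_mul _).restrict hle
    _ = _ := by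
        rw [integral_const_mul]
        field_simp

variable {μ} [Nontrivial E] [CompleteSpace F]

/-- Near a Lebesgue point the averages of `f` over balls of radius `δ` are at most
a multiple of `∫ |g|` over the ball, which tends to zero. -/
theorem ae_eq_zero_of_norm_le_pow_mul (hf : LocallyIntegrable f μ)
    (h : ∀ᵐ z ∂μ, ∃ g : E → ℝ, Integrable g μ ∧
      ∀ᵐ y ∂μ, y ∈ closedBall z 1 → ‖f y‖ ≤ ‖z - y‖ ^ finrank ℝ E * ‖g y‖) :
    f =ᵐ[μ] 0 := by
  filter_upwards [IsUnifLocDoublingMeasure.ae_tendsto_average μ hf 1, h] with z hz ⟨g, hg, hfg⟩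
  have hlim : Tendsto (fun δ => ⨍ y in closedBall z δ, f y ∂μ) (𝓝[>] 0) (𝓝 (f z)) :=
    hz (fun _ => z) id tendsto_id
      (eventually_mem_nhdsWithin.mono fun δ hδ => mem_closedBall_self (by simpa using hδ.le))
  have hzero := (hg.norm.tendsto_setIntegral_nhds_zero
    (tendsto_measure_closedBall_nhdsGT_zero μ z)).const_mul (μ.real (ball 0 1))⁻¹
  rw [mul_zero] at hzero
  refine tendsto_nhds_unique hlim (squeeze_zero_norm' ?_ hzero)
  filter_upwards [Ioc_mem_nhdsGT one_pos] with δ hδ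
  exact norm_setAverage_closedBall_le μ hg hδ.1
    (hfg.mono fun y hy hyδ => hy (closedBall_subset_closedBall hδ.2 hyδ))

end LebesguePoints

section Critical

variable {n m : ℕ} {A : Fin m → Matrix (Fin n) (Fin n) ℝ} {γs : Fin m → ℝ}
  {f : EuclideanSpace ℝ (Fin n) → ℝ}

theorem ae_norm_sub_toEuclideanLin_pos (hn : 0 < n) (hA : ∀ i, IsUnit (A i))
    (x : EuclideanSpace ℝ (Fin n)) : ∀ᵐ y, ∀ i, 0 < ‖x - Matrix.toEuclideanLin (A i) y‖ := by
  have : Nonempty (Fin n) := ⟨⟨0, hn⟩⟩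
  refine ae_all_iff.2 fun i => (Measure.ae_ne volume (Matrix.toEuclideanLin (A i)⁻¹ x)).mono
    fun y hy => norm_pos_iff.2 (sub_ne_zero.2 ?_)
  rintro rfl
  exact hy (toEuclideanLin_inv_apply_self (hA i) y).symm

theorem ae_comp_toEuclideanLin {M : Matrix (Fin n) (Fin n) ℝ} (hM : IsUnit M)
    {p : EuclideanSpace ℝ (Fin n) → Prop} (hp : ∀ᵐ x, p x) :
    ∀ᵐ y, p (Matrix.toEuclideanLin M y) := by
  refine measure_mono_null (t := Matrix.toEuclideanLin M⁻¹ '' {x | ¬ p x})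
    (fun y hy => ⟨_, hy, toEuclideanLin_inv_apply_self hM y⟩) ?_
  rw [Measure.addHaar_image_linearMap, show volume {x | ¬ p x} = 0 from hp, mul_zero]

theorem rpow_le_div_pow_mul_homKernel (hγs : ∀ i, 0 ≤ γs i) {i : Fin m} {k : ℕ}
    (hk : (k : ℝ) ≤ γs i) {D : ℝ} {x y : EuclideanSpace ℝ (Fin n)}
    (hpos : ∀ j, 0 < ‖x - Matrix.toEuclideanLin (A j) y‖)
    (hD : ∀ j, ‖x - Matrix.toEuclideanLin (A j) y‖ ≤ D) :
    D ^ (-∑ j, γs j) ≤ (‖x - Matrix.toEuclideanLin (A i) y‖ / D) ^ k * homKernel A γs x y := by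
  classical
  have hD₀ : 0 < D := (hpos i).trans_le (hD i)
  set t : Fin m → ℝ := fun j => ‖x - Matrix.toEuclideanLin (A j) y‖ / D
  have ht₀ (j) : 0 < t j := div_pos (hpos j) hD₀
  have ht₁ (j) : t j ≤ 1 := (div_le_one hD₀).2 (hD j)
  have hone : 1 ≤ t i ^ k * ∏ j, t j ^ (-γs j) := by
    rw [← Finset.mul_prod_erase _ _ (Finset.mem_univ i), ← mul_assoc, ← Real.rpow_natCast,
      ← Real.rpow_add (ht₀ i)]
    exact one_le_mul_of_one_le_of_one_le
      (Real.one_le_rpow_of_pos_of_le_one_of_nonpos (ht₀ i) (ht₁ i) (by linarith))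
      (Finset.one_le_prod fun j _ =>
        Real.one_le_rpow_of_pos_of_le_one_of_nonpos (ht₀ j) (ht₁ j) (neg_nonpos.2 (hγs j)))
  rw [homKernel_eq_rpow_mul_prod_div A γs hD₀, mul_left_comm]
  exact le_mul_of_one_le_right (by positivity) hone

theorem exists_forall_mem_closedBall_norm_sub_le (x z : EuclideanSpace ℝ (Fin n)) :
    ∃ D > 0, ∀ y ∈ Metric.closedBall z 1, ∀ j, ‖x - Matrix.toEuclideanLin (A j) y‖ ≤ D := by
  obtain ⟨B, hB, hAB⟩ := exists_norm_linearMap_le fun j => Matrix.toEuclideanLin (A j)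
  refine ⟨‖x‖ + B * (‖z‖ + 1), by positivity, fun y hy j => (norm_sub_le _ _).trans ?_⟩
  gcongr
  refine (hAB j y).trans ?_
  gcongr
  exact norm_le_norm_add_const_of_dist_le hy

theorem exists_norm_le_pow_mul_norm_homKernel_mul (hn : 0 < n) (hA : ∀ i, IsUnit (A i))
    (hγs : ∀ i, 0 ≤ γs i) {i : Fin m} {k : ℕ} (hk : (k : ℝ) ≤ γs i)
    (x z : EuclideanSpace ℝ (Fin n)) :
    ∃ C : ℝ, ∀ᵐ y, y ∈ Metric.closedBall z 1 →
      ‖f y‖ ≤ ‖x - Matrix.toEuclideanLin (A i) y‖ ^ k * ‖C * (homKernel A γs x y * f y)‖ := by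
  obtain ⟨D, hD₀, hD⟩ := exists_forall_mem_closedBall_norm_sub_le (A := A) x z
  refine ⟨D ^ (∑ j, γs j) / D ^ k, ?_⟩
  filter_upwards [ae_norm_sub_toEuclideanLin_pos hn hA x] with y hy hyz
  have hlow := rpow_le_div_pow_mul_homKernel hγs hk hy (hD y hyz)
  rw [Real.rpow_neg hD₀.le, inv_le_iff_one_le_mul₀' (by positivity)] at hlow
  calc ‖f y‖ ≤ D ^ (∑ j, γs j) * ((‖x - Matrix.toEuclideanLin (A i) y‖ / D) ^ k *
        homKernel A γs x y) * ‖f y‖ := le_mul_of_one_le_left (norm_nonneg _) hlow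
    _ = _ := by
        rw [norm_mul, norm_mul, Real.norm_of_nonneg (homKernel_nonneg A γs x y), div_pow,
          Real.norm_of_nonneg (by positivity : 0 ≤ D ^ (∑ j, γs j) / D ^ k)]
        ring

theorem locallyIntegrable_of_integrable_homKernel_mul (hn : 0 < n) (hA : ∀ i, IsUnit (A i))
    (hγs : ∀ i, 0 ≤ γs i) (i : Fin m) (hf : AEMeasurable f) {x : EuclideanSpace ℝ (Fin n)}
    (hx : Integrable fun y => homKernel A γs x y * f y) : LocallyIntegrable f := by
  intro z
  obtain ⟨C, hC⟩ := exists_norm_le_pow_mul_norm_homKernel_mul (f := f) (k := 0) hn hA hγs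
    (by simpa using hγs i) x z
  refine ⟨Metric.closedBall z 1, Metric.closedBall_mem_nhds z one_pos, ?_⟩
  refine (hx.const_mul C).norm.restrict.mono' hf.aestronglyMeasurable.restrict ?_
  filter_upwards [ae_restrict_mem measurableSet_closedBall, ae_restrict_of_ae hC] with y hy h
  simpa only [pow_zero, one_mul] using h hy

theorem ae_eq_zero_of_integrable_homKernel_mul (hn : 0 < n) (hA : ∀ i, IsUnit (A i))
    (hγs : ∀ i, 0 ≤ γs i) {i : Fin m} (hi : n ≤ γs i) (hf : AEMeasurable f)
    (hint : ∀ᵐ x, Integrable fun y => homKernel A γs x y * f y) : f =ᵐ[volume] 0 := by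
  have : Nonempty (Fin n) := ⟨⟨0, hn⟩⟩
  obtain ⟨x, hx⟩ := hint.exists
  obtain ⟨B, hB, hAB⟩ := exists_norm_linearMap_le fun j => Matrix.toEuclideanLin (A j)
  refine ae_eq_zero_of_norm_le_pow_mul
    (locallyIntegrable_of_integrable_homKernel_mul hn hA hγs i hf hx) ?_
  filter_upwards [ae_comp_toEuclideanLin (hA i) hint] with z hz
  obtain ⟨C, hC⟩ := exists_norm_le_pow_mul_norm_homKernel_mul (f := f) hn hA hγs hi
    (Matrix.toEuclideanLin (A i) z) z
  refine ⟨_, (hz.const_mul C).const_mul (B ^ n), hC.mono fun y hy hyz => (hy hyz).trans ?_⟩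
  rw [finrank_euclideanSpace_fin, ← map_sub, norm_mul (B ^ n), norm_pow,
    Real.norm_of_nonneg hB.le, ← mul_assoc (‖z - y‖ ^ n), ← mul_pow, mul_comm _ B]
  gcongr
  exact hAB i _

theorem medianOsc_homOp_eq_zero (hn : 0 < n) (hA : ∀ i, IsUnit (A i))
    (hγs : ∀ i, 0 ≤ γs i) {i : Fin m} (hi : n ≤ γs i) {s : ℝ} (hs : 0 < s) (hf : AEMeasurable f)
    (hint : ∀ᵐ x, Integrable fun y => homKernel A γs x y * f y)
    {Q : Set (EuclideanSpace ℝ (Fin n))} (hQ : IsCube Q) :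
    medianOsc s (homOp A γs f) Q = 0 := by
  obtain ⟨a, l, hl, rfl⟩ := hQ
  have hf₀ := ae_eq_zero_of_integrable_homKernel_mul hn hA hγs hi hf hint
  have hT (x) : homOp A γs f x = 0 :=
    integral_eq_zero_of_ae (hf₀.mono fun y hy => by simp [hy])
  refine nonpos_iff_eq_zero.1 (medianOsc_le_of_forall_gt 0 fun α _ => ?_)
  have hpos : 0 < ENNReal.ofReal s * volume (cube a l) :=
    ENNReal.mul_pos (by simpa using hs) (volume_cube_pos a hl).ne'
  simpa [hT, cube] using hpos

end Critical

end FracHom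

theorem theorem2p3_general {n m : ℕ} (hn : 0 < n) {A : Fin m → Matrix (Fin n) (Fin n) ℝ}
    (hA : ∀ i, IsUnit (A i)) (hAA : ∀ k k', k ≠ k' → IsUnit (A k - A k')) {γ : ℝ}
    {γs : Fin m → ℝ} (hγs : ∀ i, 0 ≤ γs i) (hsum : ∑ i, γs i = n * (1 - γ)) {s : ℝ}
    (hs : 0 < s) :
    ∃ c : ℝ≥0, ∀ f : EuclideanSpace ℝ (Fin n) → ℝ, AEMeasurable f →
      (∀ᵐ x, Integrable fun y => FracHom.homKernel A γs x y * f y) →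
      ∀ Q, FracHom.IsCube Q → FracHom.medianOsc s (FracHom.homOp A γs f) Q ≤
        c * ∑ i, ⨅ y ∈ Q, FracHom.fracMax γ f (Matrix.toEuclideanLin (A i)⁻¹ y) := by
  by_cases! hlt : ∀ i, γs i < n
  · exact FracHom.exists_medianOsc_homOp_le_of_lt hn hA hAA hγs hlt hsum hs
  · obtain ⟨i, hi⟩ := hlt
    exact ⟨0, fun f hf hint Q hQ => by
      simp [FracHom.medianOsc_homOp_eq_zero hn hA hγs hi hs hf hint hQ]⟩

theorem theorem2p3 (n m : ℕ) (hn : 0 < n)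
    (A : Fin m → Matrix (Fin n) (Fin n) ℝ)
    (hA : ∀ i, IsUnit (A i))
    (hAA : ∀ k k', k ≠ k' → IsUnit (A k - A k'))
    (γ : ℝ) (hγ0 : 0 ≤ γ) (hγ1 : γ < 1)
    (γs : Fin m → ℝ) (hγs : ∀ i, 0 < γs i) (hsum : ∑ i, γs i = n * (1 - γ))
    (s : ℝ) (hs0 : 0 < s) (hs1 : s ≤ 1 / 2) :
    ∃ c : ℝ≥0, ∀ f : EuclideanSpace ℝ (Fin n) → ℝ, AEMeasurable f volume →
      (∀ᵐ x, Integrable (fun y => FracHom.homKernel A γs x y * f y) volume) →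
      ∀ Q₀ : Set (EuclideanSpace ℝ (Fin n)), FracHom.IsCube Q₀ → ∀ x ∈ Q₀,
        FracHom.localSharp s Q₀ (FracHom.homOp A γs f) x ≤
          c * ∑ i, ⨆ (Q : Set (EuclideanSpace ℝ (Fin n))) (_ : FracHom.IsCube Q) (_ : x ∈ Q)
            (_ : Q ⊆ Q₀), ⨅ y ∈ Q, FracHom.fracMax γ f (Matrix.toEuclideanLin (A i)⁻¹ y) := by
  obtain ⟨c, hc⟩ := theorem2p3_general hn hA hAA (fun i => (hγs i).le) hsum hs0
  exact ⟨c, fun f hf hint Q₀ _ x _ => FracHom.localSharp_le_mul_sum_iSup (hc f hf hint) Q₀ x⟩
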